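/- Let $k\ge 1$ and let $A$ be a real $k\times k$ matrix all of whose eigenvalues are real and lie in $[-1,1]$. Let $0<\delta<1$ and assume that $A$ is $\delta$-condense, that is, every eigenvalue of $A$ in $[-1,-\delta]\cup[\delta,1]$ is semisimple (its algebraic multiplicity equals its geometric multiplicity). Let $m\ge 1$ be the size of the largest Jordan block in the Jordan form of $A$. Let $f$ be a real function on $[-1,1]$ such that $f\in C^{m-1}([-1,1])$ (with one-sided derivatives at the endpoints), $f^{(m-1)}$ is absolutely continuous on $[-1,1]$, and its almost everywhere defined derivative $f^{(m)}$ is of bounded variation, i.e. agrees almost everywhere with a function of finite total variation on $[-1,1]$. Let $T_n$ be the $n$-th Chebyshev polynomial of the first kind and \[ \alpha_n[f]=\frac{2}{\pi}\int_{-1}^{1}\frac{f(t)\,T_n(t)}{\sqrt{1-t^2}}\,dt ,\qquad n=0,1,2,\ldots \] Then the matrix Chebyshev expansion \[ \mathcal{S}_\infty(f)(A)=\tfrac12\alpha_0[f]\,T_0(A)+\sum_{n=1}^{\infty}\alpha_n[f]\,T_n(A) \] is absolutely convergent: for every sub-multiplicative norm $\|\cdot\|$ on the real $k\times k$ matrices,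 $\sum_{n=0}^\infty \|\alpha_n[f]\,T_n(A)\|<\infty$; in particular, the partial sums converge to a matrix. -/

import Mathlib

open MeasureTheory Set Filter Topology

namespace MatrixChebyshev

/-- The Jordan block of order `n` with eigenvalue `c`:
`c` on the diagonal, `1` on the first superdiagonal, `0` elsewhere. -/
def jordanBlock (n : ℕ) (c : ℝ) : Matrix (Fin n) (Fin n) ℝ :=
  Matrix.of fun i j => if i = j then c else if (i : ℕ) + 1 = (j : ℕ) then 1 else 0

/-- `A = Z⁻¹ J Z`, where `J` is the block diagonal matrix whose diagonal blocks are the (nonempty)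
Jordan blocks `J_i` of order `size i` with eigenvalue `eig i`, `i < p`.
The bijection `e` numbers the rows and columns of `J` by `0, …, k - 1`. -/
def HasJordanForm {k : ℕ} (A : Matrix (Fin k) (Fin k) ℝ) (p : ℕ) (size : Fin p → ℕ)
    (eig : Fin p → ℝ) : Prop :=
  (∀ i, 0 < size i) ∧
    ∃ (e : ((i : Fin p) × Fin (size i)) ≃ Fin k) (Z : GL (Fin k) ℝ),
      A = (↑Z⁻¹ : Matrix (Fin k) (Fin k) ℝ) *
        Matrix.reindex e e (Matrix.blockDiagonal' fun i => jordanBlock (size i) (eig i)) *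
        (↑Z : Matrix (Fin k) (Fin k) ℝ)

/-- `m` is the size of the largest Jordan block in the Jordan form of `A`
(the Jordan form is unique up to the order of the blocks). -/
def IsLargestJordanBlockSize {k : ℕ} (A : Matrix (Fin k) (Fin k) ℝ) (m : ℕ) : Prop :=
  ∃ (p : ℕ) (size : Fin p → ℕ) (eig : Fin p → ℝ),
    HasJordanForm A p size eig ∧ IsGreatest (range size) m

/-- An eigenvalue `c` of `A` is semisimple if its algebraic multiplicity
is equal to its geometric multiplicity. -/
def IsSemisimpleEigenvalue {k : ℕ} (A : Matrix (Fin k) (Fin k) ℝ) (c : ℝ) : Prop :=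
  A.charpoly.rootMultiplicity c =
    Module.finrank ℝ (Module.End.eigenspace (Matrix.toLin' A) c)

/-- A real square matrix with real spectrum and spectral radius at most one is `δ`-condense if all
its eigenvalues in `[-1, -δ] ∪ [δ, 1]` are semisimple. -/
structure IsCondense {k : ℕ} (δ : ℝ) (A : Matrix (Fin k) (Fin k) ℝ) : Prop where
  real_spectrum : A.charpoly.Splits
  abs_le_one : ∀ c : ℝ, Module.End.HasEigenvalue (Matrix.toLin' A) c → |c| ≤ 1
  semisimple : ∀ c ∈ Icc (-1) (-δ) ∪ Icc δ 1,
    Module.End.HasEigenvalue (Matrix.toLin' A) c → IsSemisimpleEigenvalue A c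

/-- The derivative of `h` on `[-1, 1]`, which need only exist almost everywhere, is of bounded
variation: it agrees almost everywhere with a function of finite total variation on `[-1, 1]`. -/
def HasDerivOfBoundedVariation (h : ℝ → ℝ) : Prop :=
  ∃ g : ℝ → ℝ, BoundedVariationOn g (Icc (-1) 1) ∧
    ∀ᵐ x ∂(volume.restrict (Icc (-1 : ℝ) 1)), HasDerivWithinAt h (g x) (Icc (-1) 1) x

/-- The Chebyshev coefficient
`α_n[f] = (2 / π) ∫_{-1}^{1} f(t) T_n(t) / √(1 - t²) dt`. -/
noncomputable def chebyshevCoeff (f : ℝ → ℝ) (n : ℕ) : ℝ :=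
  2 / Real.pi *
    ∫ t in (-1 : ℝ)..1, f t * (Polynomial.Chebyshev.T ℝ n).eval t / Real.sqrt (1 - t ^ 2)

/-- The `n`-th term of the matrix Chebyshev expansion of `f` at `A`:
`α_n[f] T_n(A)`, halved when `n = 0`. -/
noncomputable def chebyshevTerm {k : ℕ} (f : ℝ → ℝ) (A : Matrix (Fin k) (Fin k) ℝ) (n : ℕ) :
    Matrix (Fin k) (Fin k) ℝ :=
  ((if n = 0 then 1 / 2 else 1) * chebyshevCoeff f n) •
    Polynomial.aeval A (Polynomial.Chebyshev.T ℝ n)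

/-- The partial sum `S_N(f)(A)` of the matrix Chebyshev expansion. -/
noncomputable def chebyshevPartialSum {k : ℕ} (f : ℝ → ℝ) (A : Matrix (Fin k) (Fin k) ℝ)
    (N : ℕ) : Matrix (Fin k) (Fin k) ℝ :=
  ∑ n ∈ Finset.range (N + 1), chebyshevTerm f A n

end MatrixChebyshev

/-! Two rates are balanced: `α_n[f]` is `O(n^-(m+1))`, while the entries of `T_n(A)` are
`O(n^(m-1))`. The terms are then entrywise `O(n^-2)`, and the entries control every matrix norm.

Coefficients: integrating by parts against `√(1 - t²) U_n(t)`, which is `sin((n+1)θ)` at `t = cos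
θ`, gives `α_{n+1}[f] = (α_n[f'] - α_{n+2}[f']) / (2(n+1))` (`chebyshevCoeff_succ`). So each
derivative gains a power of `n`. After `m` steps there remains a function of bounded variation,
whose coefficients are `O(1/n)` by a second mean value estimate (`abs_integral_mul_le_of_monotone`).

Growth: on a block `c + N` with `N` nilpotent, `T_n` is a finite Taylor sum in `T_n^(j)(c) / j!`
with `j < m`. For `|c| < 1` these are `O(n^j)` (`isBigO_eval_iterate_derivative_T`). Eigenvalues
with `|c| ≥ δ` are semisimple, so their blocks have size one (`HasJordanForm.size_eq_one`), where
`|T_n(c)| ≤ 1` suffices. -/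

namespace MatrixChebyshev

/-! ### Decay of the Chebyshev coefficients. -/

section Coefficients

open Polynomial.Chebyshev

/-- The function `√(1 - t²) U_n(t)`, a primitive of `-(n + 1) T_{n + 1}(t) / √(1 - t²)`. -/
noncomputable def weightedU (n : ℕ) (t : ℝ) : ℝ := √(1 - t ^ 2) * (U ℝ n).eval t

/-- The integrand `T_n(t) / √(1 - t²)` of the Chebyshev coefficients. -/
noncomputable def weightedT (n : ℕ) (t : ℝ) : ℝ := (T ℝ n).eval t * √(1 - t ^ 2)⁻¹

lemma chebyshevCoeff_eq (f : ℝ → ℝ) (n : ℕ) :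
    chebyshevCoeff f n = 2 / Real.pi * ∫ t in (-1 : ℝ)..1, f t * weightedT n t := by
  simp only [chebyshevCoeff, weightedT, Real.sqrt_inv, div_eq_mul_inv, mul_assoc]

lemma intervalIntegrable_weightedT (n : ℕ) : IntervalIntegrable (weightedT n) volume (-1) 1 :=
  intervalIntegrable_sqrt_one_sub_sq_inv.continuousOn_mul (Polynomial.continuous _).continuousOn

lemma continuous_weightedU (n : ℕ) : Continuous (weightedU n) := by
  unfold weightedU
  fun_prop

lemma weightedU_one (n : ℕ) : weightedU n 1 = 0 := by simp [weightedU]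

lemma weightedU_neg_one (n : ℕ) : weightedU n (-1) = 0 := by simp [weightedU]

lemma abs_weightedU_le_one (n : ℕ) {t : ℝ} (ht : t ∈ Icc (-1 : ℝ) 1) : |weightedU n t| ≤ 1 := by
  have h := U_real_cos (Real.arccos t) n
  rw [Real.cos_arccos ht.1 ht.2, Real.sin_arccos] at h
  rw [weightedU, mul_comm, h]
  exact Real.abs_sin_le_one _

/-- At `t = cos θ` this is `2 sin θ sin((n+1)θ) = cos(nθ) - cos((n+2)θ)`. -/
lemma weightedU_eq {t : ℝ} (ht : t ∈ Ioo (-1 : ℝ) 1) (n : ℕ) :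
    weightedU n t = (weightedT n t - weightedT (n + 2) t) / 2 := by
  have hpos : 0 < 1 - t ^ 2 := by nlinarith [ht.1, ht.2]
  have h1 := congrArg (Polynomial.eval t) (one_sub_X_sq_mul_U_eq_pol_in_T ℝ n)
  have h2 := congrArg (Polynomial.eval t) (T_add_two ℝ n)
  simp only [Polynomial.eval_mul, Polynomial.eval_sub, Polynomial.eval_one, Polynomial.eval_pow,
    Polynomial.eval_X, Polynomial.eval_ofNat] at h1 h2
  have hs : √(1 - t ^ 2) ≠ 0 := (Real.sqrt_pos.2 hpos).ne'
  have hsq := Real.mul_self_sqrt hpos.le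
  simp only [weightedU, weightedT, Real.sqrt_inv]
  push_cast
  field_simp
  rw [Real.sq_sqrt hpos.le]
  linear_combination 2 * h1 - h2

lemma hasDerivAt_weightedU {t : ℝ} (ht : t ∈ Ioo (-1 : ℝ) 1) (n : ℕ) :
    HasDerivAt (weightedU n) (-((n : ℝ) + 1) * weightedT (n + 1) t) t := by
  have hpos : 0 < 1 - t ^ 2 := by nlinarith [ht.1, ht.2]
  have hs : √(1 - t ^ 2) ≠ 0 := (Real.sqrt_pos.2 hpos).ne'
  have h1 : HasDerivAt (fun t : ℝ => 1 - t ^ 2) (-(2 * t)) t := by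
    simpa using! (hasDerivAt_pow 2 t).const_sub 1
  have h := (h1.sqrt hpos.ne').mul ((U ℝ n).hasDerivAt t)
  refine h.congr_deriv ?_
  have h2 := congrArg (Polynomial.eval t) (add_one_mul_T_eq_poly_in_U (R := ℝ) n)
  simp only [Polynomial.eval_mul, Polynomial.eval_sub, Polynomial.eval_one, Polynomial.eval_pow,
    Polynomial.eval_X, Polynomial.eval_add, Polynomial.eval_intCast] at h2
  simp only [weightedT, Real.sqrt_inv]
  push_cast at h2 ⊢
  field_simp
  rw [Real.sq_sqrt hpos.le]
  linear_combination h2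

lemma integral_weightedT (n : ℕ) {t : ℝ} (ht : t ∈ Icc (-1 : ℝ) 1) :
    ∫ x in (-1 : ℝ)..t, -((n : ℝ) + 1) * weightedT (n + 1) x = weightedU n t := by
  rw [intervalIntegral.integral_eq_sub_of_hasDerivAt_of_le ht.1
    (continuous_weightedU n).continuousOn
    (fun x hx => hasDerivAt_weightedU ⟨hx.1, hx.2.trans_le ht.2⟩ n), weightedU_neg_one, sub_zero]
  refine ((intervalIntegrable_weightedT (n + 1)).const_mul _).mono_set ?_
  rw [uIcc_of_le ht.1, uIcc_of_le (by norm_num)]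
  exact Icc_subset_Icc_right ht.2

lemma _root_.AbsolutelyContinuousOnInterval.congr {f g : ℝ → ℝ} {a b : ℝ}
    (hf : AbsolutelyContinuousOnInterval f a b) (h : EqOn f g (uIcc a b)) :
    AbsolutelyContinuousOnInterval g a b := by
  rw [absolutelyContinuousOnInterval_iff] at hf ⊢
  intro ε hε
  obtain ⟨δ, hδ, H⟩ := hf ε hε
  refine ⟨δ, hδ, fun E hE hlen => ?_⟩
  convert! H E hE hlen using 1
  refine Finset.sum_congr rfl fun i hi => ?_
  rw [h (hE.1 i hi).1, h (hE.1 i hi).2]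

/-- The derivative is unbounded near `±1`, so a Lipschitz bound is not available; an indefinite
integral of an integrable function is still absolutely continuous. -/
lemma absolutelyContinuousOnInterval_weightedU (n : ℕ) :
    AbsolutelyContinuousOnInterval (weightedU n) (-1) 1 := by
  refine AbsolutelyContinuousOnInterval.congr
    (((intervalIntegrable_weightedT (n + 1)).const_mul
      (-((n : ℝ) + 1))).absolutelyContinuousOnInterval_intervalIntegral left_mem_uIcc) ?_
  intro t ht
  rw [uIcc_of_le (by norm_num)] at ht
  exact integral_weightedT n ht

lemma ae_mem_uIoc_imp_mem_Ioo :
    ∀ᵐ x : ℝ, x ∈ uIoc (-1 : ℝ) 1 → x ∈ Ioo (-1 : ℝ) 1 := by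
  filter_upwards [Measure.ae_ne volume (1 : ℝ)] with x hx h
  rw [uIoc_of_le (by norm_num)] at h
  exact ⟨h.1, lt_of_le_of_ne h.2 hx⟩

/-- Integration by parts expresses the Chebyshev coefficients of an absolutely continuous function
through those of its derivative. -/
lemma chebyshevCoeff_succ {f g : ℝ → ℝ} (hf : AbsolutelyContinuousOnInterval f (-1) 1)
    (hfg : ∀ᵐ x ∂(volume.restrict (Icc (-1 : ℝ) 1)), HasDerivWithinAt f (g x) (Icc (-1) 1) x)
    (hg : ∀ n, IntervalIntegrable (fun t => g t * weightedT n t) volume (-1) 1) (n : ℕ) :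
    chebyshevCoeff f (n + 1) =
      (chebyshevCoeff g n - chebyshevCoeff g (n + 2)) / (2 * ((n : ℝ) + 1)) := by
  have hn : (n : ℝ) + 1 ≠ 0 := by positivity
  have hibp := hf.integral_mul_deriv_eq_deriv_mul (absolutelyContinuousOnInterval_weightedU n)
  rw [weightedU_one, weightedU_neg_one] at hibp
  have h1 : ∫ x in (-1 : ℝ)..1, f x * deriv (weightedU n) x =
      -((n : ℝ) + 1) * ∫ x in (-1 : ℝ)..1, f x * weightedT (n + 1) x := by
    rw [← intervalIntegral.integral_const_mul]
    refine intervalIntegral.integral_congr_ae ?_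
    filter_upwards [ae_mem_uIoc_imp_mem_Ioo] with x hx hx'
    rw [(hasDerivAt_weightedU (hx hx') n).deriv]
    ring
  have h2 : ∫ x in (-1 : ℝ)..1, deriv f x * weightedU n x =
      ((∫ x in (-1 : ℝ)..1, g x * weightedT n x) -
        ∫ x in (-1 : ℝ)..1, g x * weightedT (n + 2) x) / 2 := by
    rw [← intervalIntegral.integral_sub (hg n) (hg (n + 2)), ← intervalIntegral.integral_div]
    refine intervalIntegral.integral_congr_ae ?_
    rw [ae_restrict_iff' measurableSet_Icc] at hfg
    filter_upwards [ae_mem_uIoc_imp_mem_Ioo, hfg] with x hx hfx hx'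
    have hx := hx hx'
    rw [((hfx ⟨hx.1.le, hx.2.le⟩).hasDerivAt (Icc_mem_nhds hx.1 hx.2)).deriv, weightedU_eq hx]
    ring
  rw [h1, h2] at hibp
  simp only [chebyshevCoeff_eq]
  field_simp
  linear_combination -2 * hibp

/-- If the primitive of `φ` is bounded by `K`, then the integral of `φ` over a superlevel set of
a monotone function is bounded by `2 K`. -/
lemma abs_integral_indicator_superlevel_le {φ g : ℝ → ℝ} {a b K : ℝ} (hab : a ≤ b)
    (hφ : IntervalIntegrable φ volume a b) (hK : ∀ t ∈ Icc a b, |∫ x in a..t, φ x| ≤ K)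
    (hg : Monotone g) (s : ℝ) :
    |∫ x in a..b, {t | s < g t}.indicator φ x| ≤ 2 * K := by
  have hK0 : 0 ≤ K := (abs_nonneg _).trans (hK a (left_mem_Icc.2 hab))
  rcases (Icc a b ∩ {t | s < g t}).eq_empty_or_nonempty with he | hne
  · rw [intervalIntegral.integral_congr (g := fun _ => 0)]
    · simpa using hK0
    · intro x hx
      rw [uIcc_of_le hab] at hx
      exact indicator_of_notMem (s := {t | s < g t}) (fun h => eq_empty_iff_forall_notMem.1 he x ⟨hx, h⟩) _
  · set S := Icc a b ∩ {t | s < g t}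
    have hbd : BddBelow S := ⟨a, fun x hx => hx.1.1⟩
    set c := sInf S
    obtain ⟨y, hy⟩ := hne
    have hac : a ≤ c := le_csInf ⟨y, hy⟩ fun x hx => hx.1.1
    have hcb : c ≤ b := (csInf_le hbd hy).trans hy.1.2
    have hi1 : IntervalIntegrable φ volume a c := hφ.mono_set (by
      rw [uIcc_of_le hac, uIcc_of_le hab]; exact Icc_subset_Icc_right hcb)
    have hi2 : IntervalIntegrable φ volume c b := hφ.mono_set (by
      rw [uIcc_of_le hcb, uIcc_of_le hab]; exact Icc_subset_Icc_left hac)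
    -- By monotonicity the superlevel set is, up to its left endpoint, `(c, b]`; the integral is
    -- thus a difference of two values of the primitive.
    have key : ∫ x in a..b, {t | s < g t}.indicator φ x = ∫ x in c..b, φ x := by
      rw [intervalIntegral.integral_of_le hab, intervalIntegral.integral_of_le hcb,
        ← integral_indicator measurableSet_Ioc, ← integral_indicator measurableSet_Ioc]
      refine integral_congr_ae ?_
      filter_upwards [Measure.ae_ne volume a, Measure.ae_ne volume c] with x hxa hxc
      by_cases hx : x ∈ Ioc c b
      · obtain ⟨z, hz, hzx⟩ := exists_lt_of_csInf_lt ⟨y, hy⟩ hx.1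
        rw [indicator_of_mem hx, indicator_of_mem (show x ∈ Ioc a b from ⟨hac.trans_lt hx.1, hx.2⟩),
          indicator_of_mem (show x ∈ {t | s < g t} from lt_of_lt_of_le hz.2 (hg hzx.le))]
      · rw [indicator_of_notMem hx]
        by_cases hx' : x ∈ Ioc a b
        · rw [indicator_of_mem hx']
          refine indicator_of_notMem (fun h => hx ⟨?_, hx'.2⟩) _
          exact lt_of_le_of_ne (csInf_le hbd ⟨⟨hx'.1.le, hx'.2⟩, h⟩) hxc.symm
        · rw [indicator_of_notMem hx']
    have hadd := intervalIntegral.integral_add_adjacent_intervals hi1 hi2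
    have e1 := abs_le.1 (hK c ⟨hac, hcb⟩)
    have e2 := abs_le.1 (hK b ⟨hab, le_rfl⟩)
    rw [key, abs_le]
    constructor <;> linarith [e1.1, e1.2, e2.1, e2.2]

/-- A weak form of the second mean value theorem: the integral of `g φ` with `g` monotone is
controlled by the primitive of `φ`. -/
lemma abs_integral_mul_le_of_monotone {φ g : ℝ → ℝ} {a b K : ℝ} (hab : a ≤ b)
    (hφ : IntervalIntegrable φ volume a b) (hK : ∀ t ∈ Icc a b, |∫ x in a..t, φ x| ≤ K)
    (hg : Monotone g) :
    |∫ x in a..b, g x * φ x| ≤ (|g a| + 2 * (g b - g a)) * K := by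
  have hgab : g a ≤ g b := hg hab
  -- Layer-cake formula for `g - g a`: after Fubini only superlevel sets of `g` remain.
  have hind : ∀ x ∈ Icc a b,
      g x * φ x = g a * φ x + ∫ s in g a..g b, {t | s < g t}.indicator φ x := by
    intro x hx
    have h1 : g a ≤ g x := hg hx.1
    have h2 : g x ≤ g b := hg hx.2
    have : ∫ s in g a..g b, {t | s < g t}.indicator φ x = (g x - g a) * φ x := by
      have e : (fun s => {t | s < g t}.indicator φ x) = (Iio (g x)).indicator fun _ => φ x := by
        ext s
        simp [indicator_apply]
      rw [intervalIntegral.integral_of_le hgab, e, integral_indicator measurableSet_Iio,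
        setIntegral_const, measureReal_restrict_apply measurableSet_Iio]
      have : volume.real (Iio (g x) ∩ Ioc (g a) (g b)) = g x - g a := by
        rw [show Iio (g x) ∩ Ioc (g a) (g b) = Ioo (g a) (g x) from by
          ext s; simp only [mem_inter_iff, mem_Iio, mem_Ioc, mem_Ioo]; grind,
          Real.volume_real_Ioo_of_le h1]
      rw [this, smul_eq_mul]
    rw [this]
    ring
  have hmeas : MeasurableSet {p : ℝ × ℝ | p.2 < g p.1} :=
    measurableSet_lt measurable_snd (hg.measurable.comp measurable_fst)
  have hprod : Integrable (Function.uncurry fun x s => {t | s < g t}.indicator φ x)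
      ((volume.restrict (uIoc a b)).prod (volume.restrict (uIoc (g a) (g b)))) := by
    have : IsFiniteMeasure (volume.restrict (uIoc (g a) (g b))) :=
      ⟨by rw [Measure.restrict_apply_univ, uIoc_of_le hgab]; exact measure_Ioc_lt_top⟩
    have h := (intervalIntegrable_iff.1 hφ).integrable.comp_fst
      (volume.restrict (uIoc (g a) (g b)))
    refine (h.indicator hmeas).congr (ae_of_all _ fun p => ?_)
    simp [Function.uncurry, indicator_apply]
  have hint : IntervalIntegrable (fun x => ∫ s in g a..g b, {t | s < g t}.indicator φ x)
      volume a b := by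
    rw [intervalIntegrable_iff]
    simp only [intervalIntegral.integral_of_le hgab]
    rw [uIoc_of_le hgab] at hprod
    exact hprod.integral_prod_left
  rw [intervalIntegral.integral_congr (fun x hx => hind x (by rwa [uIcc_of_le hab] at hx)),
    intervalIntegral.integral_add (hφ.const_mul _) hint, intervalIntegral.integral_const_mul,
    intervalIntegral_intervalIntegral_swap
      (by rwa [IntegrableOn, Measure.volume_eq_prod, ← Measure.prod_restrict]), add_mul]
  refine (abs_add_le _ _).trans (add_le_add ?_ ?_)
  · rw [abs_mul]
    exact mul_le_mul_of_nonneg_left (hK b ⟨hab, le_rfl⟩) (abs_nonneg _)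
  · have := intervalIntegral.norm_integral_le_of_norm_le_const (a := g a) (b := g b)
      (C := 2 * K) (f := fun s => ∫ x in a..b, {t | s < g t}.indicator φ x)
      (fun s _ => abs_integral_indicator_superlevel_le hab hφ hK hg s)
    rw [abs_of_nonneg (sub_nonneg.2 hgab)] at this
    calc _ ≤ _ := this
      _ = _ := by ring

/-- Jordan decomposition, with both parts extended to be monotone on the whole line and hence
measurable. -/
lemma _root_.BoundedVariationOn.exists_monotone_sub_monotone {g : ℝ → ℝ} {a b : ℝ} (hab : a ≤ b)
    (hg : BoundedVariationOn g (Icc a b)) :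
    ∃ p q : ℝ → ℝ, Monotone p ∧ Monotone q ∧ ∀ x ∈ Icc a b, g x = p x - q x := by
  obtain ⟨p, q, hp, hq, rfl⟩ := hg.locallyBoundedVariationOn.exists_monotoneOn_sub_monotoneOn
  have ext : ∀ p : ℝ → ℝ, MonotoneOn p (Icc a b) →
      ∃ p' : ℝ → ℝ, Monotone p' ∧ EqOn p p' (Icc a b) := fun p hp =>
    hp.exists_monotone_extension
      ⟨p a, by rintro _ ⟨x, hx, rfl⟩; exact hp (left_mem_Icc.2 hab) hx hx.1⟩
      ⟨p b, by rintro _ ⟨x, hx, rfl⟩; exact hp hx (right_mem_Icc.2 hab) hx.2⟩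
  obtain ⟨p', hp', hpe⟩ := ext p hp
  obtain ⟨q', hq', hqe⟩ := ext q hq
  exact ⟨p', q', hp', hq', fun x hx => by rw [Pi.sub_apply, hpe hx, hqe hx]⟩

lemma intervalIntegrable_monotone_mul {p φ : ℝ → ℝ} {a b : ℝ} (hab : a ≤ b) (hp : Monotone p)
    (hφ : IntervalIntegrable φ volume a b) :
    IntervalIntegrable (fun x => p x * φ x) volume a b := by
  rw [intervalIntegrable_iff, uIoc_of_le hab] at hφ ⊢
  refine hφ.bdd_mul (c := max |p a| |p b|) hp.measurable.aestronglyMeasurable ?_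
  refine (ae_restrict_iff' measurableSet_Ioc).2 (ae_of_all _ fun x hx => ?_)
  exact abs_le_max_abs_abs (hp hx.1.le) (hp hx.2)

lemma _root_.BoundedVariationOn.intervalIntegrable_mul_weightedT {g : ℝ → ℝ}
    (hg : BoundedVariationOn g (Icc (-1) 1)) (n : ℕ) :
    IntervalIntegrable (fun t => g t * weightedT n t) volume (-1) 1 := by
  obtain ⟨p, q, hp, hq, h⟩ := hg.exists_monotone_sub_monotone (by norm_num)
  have hle : (-1 : ℝ) ≤ 1 := by norm_num
  refine ((intervalIntegrable_monotone_mul hle hp (intervalIntegrable_weightedT n)).sub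
    (intervalIntegrable_monotone_mul hle hq (intervalIntegrable_weightedT n))).congr ?_
  intro x hx
  rw [uIoc_of_le hle] at hx
  simp only [h x ⟨hx.1.le, hx.2⟩, sub_mul]

lemma abs_integral_weightedT_succ_le (n : ℕ) {t : ℝ} (ht : t ∈ Icc (-1 : ℝ) 1) :
    |∫ x in (-1 : ℝ)..t, weightedT (n + 1) x| ≤ 1 / ((n : ℝ) + 1) := by
  have h := integral_weightedT n ht
  rw [intervalIntegral.integral_const_mul] at h
  have h' := abs_weightedU_le_one n ht
  rw [← h, abs_mul, abs_neg, abs_of_pos (by positivity)] at h'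
  rwa [le_div_iff₀' (by positivity)]

/-- The Chebyshev coefficients of a function of bounded variation are `O(1 / n)`. -/
lemma exists_abs_chebyshevCoeff_mul_le_of_boundedVariationOn {g : ℝ → ℝ}
    (hg : BoundedVariationOn g (Icc (-1) 1)) :
    ∃ C, ∀ n : ℕ, |chebyshevCoeff g (n + 1)| * ((n : ℝ) + 1) ≤ C := by
  obtain ⟨p, q, hp, hq, h⟩ := hg.exists_monotone_sub_monotone (by norm_num)
  have hle : (-1 : ℝ) ≤ 1 := by norm_num
  refine ⟨2 / Real.pi * ((|p (-1)| + 2 * (p 1 - p (-1))) + (|q (-1)| + 2 * (q 1 - q (-1)))),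
    fun n => ?_⟩
  have hφ := intervalIntegrable_weightedT (n + 1)
  have e : ∫ t in (-1 : ℝ)..1, g t * weightedT (n + 1) t =
      (∫ t in (-1 : ℝ)..1, p t * weightedT (n + 1) t) -
        ∫ t in (-1 : ℝ)..1, q t * weightedT (n + 1) t := by
    rw [← intervalIntegral.integral_sub (intervalIntegrable_monotone_mul hle hp hφ)
      (intervalIntegrable_monotone_mul hle hq hφ)]
    refine intervalIntegral.integral_congr fun x hx => ?_
    rw [uIcc_of_le hle] at hx
    simp only [h x hx, sub_mul]
  have bd := fun {r : ℝ → ℝ} (hr : Monotone r) => abs_integral_mul_le_of_monotone hle hφ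
    (fun t ht => abs_integral_weightedT_succ_le n ht) hr
  have hn : (0 : ℝ) < (n : ℝ) + 1 := by positivity
  rw [chebyshevCoeff_eq, e, abs_mul, abs_of_pos (by positivity), mul_assoc]
  refine mul_le_mul_of_nonneg_left ?_ (by positivity)
  rw [← le_div_iff₀ hn]
  refine (abs_sub _ _).trans ((add_le_add (bd hp) (bd hq)).trans_eq ?_)
  ring

/-- The recursion `a_{n+1} = (b_n - b_{n+2}) / (2 (n + 1))` improves the decay by one order. -/
lemma exists_abs_mul_pow_succ_le {a b : ℕ → ℝ} {p : ℕ}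
    (hab : ∀ n : ℕ, a (n + 1) = (b n - b (n + 2)) / (2 * ((n : ℝ) + 1)))
    (hb : ∃ C, ∀ n : ℕ, |b (n + 1)| * ((n : ℝ) + 1) ^ p ≤ C) :
    ∃ C, ∀ n : ℕ, |a (n + 1)| * ((n : ℝ) + 1) ^ (p + 1) ≤ C := by
  obtain ⟨C, hC⟩ := hb
  have hC0 : 0 ≤ C := (by positivity : (0 : ℝ) ≤ _).trans (hC 0)
  have hb2 : ∀ n : ℕ, |b (n + 2)| * ((n : ℝ) + 1) ^ p ≤ C := fun n => by
    refine le_trans ?_ (hC (n + 1))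
    push_cast
    gcongr
    linarith
  -- The hypothesis says nothing about `b 0`, which is added separately; the index shift costs `2 ^
  -- p`, from `n + 2 ≤ 2 (n + 1)`.
  have hb0 : ∀ n : ℕ, |b n| * ((n : ℝ) + 1) ^ p ≤ |b 0| + 2 ^ p * C := by
    rintro (_ | n)
    · simp only [Nat.cast_zero, zero_add, one_pow, mul_one]
      linarith [show 0 ≤ 2 ^ p * C by positivity]
    · have h1 : |b (n + 1)| * (((n + 1 : ℕ) : ℝ) + 1) ^ p ≤
          |b (n + 1)| * (2 * ((n : ℝ) + 1)) ^ p := by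
        push_cast
        gcongr
        linarith [(Nat.cast_nonneg n : (0 : ℝ) ≤ n)]
      rw [mul_pow] at h1
      have h2 := mul_le_mul_of_nonneg_left (hC n) (show (0 : ℝ) ≤ 2 ^ p by positivity)
      linarith [abs_nonneg (b 0)]
  refine ⟨(|b 0| + 2 ^ p * C + C) / 2, fun n => ?_⟩
  have hn : (0 : ℝ) < (n : ℝ) + 1 := by positivity
  rw [hab, abs_div, abs_of_pos (show 0 < 2 * ((n : ℝ) + 1) by positivity), pow_succ]
  have h3 : |b n - b (n + 2)| / (2 * ((n : ℝ) + 1)) * (((n : ℝ) + 1) ^ p * ((n : ℝ) + 1)) =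
      |b n - b (n + 2)| * ((n : ℝ) + 1) ^ p / 2 := by
    field_simp
  rw [h3]
  have h4 := mul_le_mul_of_nonneg_right (abs_sub (b n) (b (n + 2)))
    (show (0 : ℝ) ≤ ((n : ℝ) + 1) ^ p by positivity)
  linarith [hb0 n, hb2 n]

/-- If `f` is `C^j`, its `j`-th derivative is absolutely continuous and the derivative of that is
of bounded variation, then the Chebyshev coefficients of `f` are `O(1 / n ^ (j + 2))`. -/
theorem exists_abs_chebyshevCoeff_mul_pow_le (j : ℕ) {f : ℝ → ℝ}
    (hf : ContDiffOn ℝ (j : WithTop ℕ∞) f (Icc (-1) 1))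
    (hac : AbsolutelyContinuousOnInterval (iteratedDerivWithin j f (Icc (-1) 1)) (-1) 1)
    (hbv : HasDerivOfBoundedVariation (iteratedDerivWithin j f (Icc (-1) 1))) :
    ∃ C, ∀ n : ℕ, |chebyshevCoeff f (n + 1)| * ((n : ℝ) + 1) ^ (j + 2) ≤ C := by
  induction j generalizing f with
  | zero =>
    rw [iteratedDerivWithin_zero] at hac hbv
    obtain ⟨g, hg, hfg⟩ := hbv
    refine exists_abs_mul_pow_succ_le
      (chebyshevCoeff_succ hac hfg hg.intervalIntegrable_mul_weightedT) ?_
    simpa using exists_abs_chebyshevCoeff_mul_le_of_boundedVariationOn hg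
  | succ j ih =>
    have huniq : UniqueDiffOn ℝ (Icc (-1 : ℝ) 1) := uniqueDiffOn_Icc (by norm_num)
    have hIcc : uIcc (-1 : ℝ) 1 = Icc (-1) 1 := uIcc_of_le (by norm_num)
    -- Peeling off the innermost derivative turns the hypotheses on `f` into those of the induction
    -- for `f'`.
    rw [iteratedDerivWithin_succ'] at hac hbv
    rw [Nat.cast_add, Nat.cast_one] at hf
    have hf1 : ContDiffOn ℝ 1 f (Icc (-1) 1) := hf.of_le le_add_self
    have hf' := hf.derivWithin huniq le_rfl
    have hcont : ContinuousOn (derivWithin f (Icc (-1) 1)) (uIcc (-1) 1) := by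
      rw [hIcc]
      exact hf'.continuousOn
    refine exists_abs_mul_pow_succ_le (chebyshevCoeff_succ (g := derivWithin f (Icc (-1) 1))
      (hIcc ▸ hf1).absolutelyContinuousOnInterval ?_
      fun n => (intervalIntegrable_weightedT n).continuousOn_mul hcont) (ih hf' hac hbv)
    refine (ae_restrict_iff' measurableSet_Icc).2 (ae_of_all _ fun x hx => ?_)
    exact (hf1.differentiableOn one_ne_zero x hx).hasDerivWithinAt

end Coefficients
-- Growth of `T_n` on a Jordan block.
section Growth

open Polynomial Asymptotics

/-- Inside `(-1, 1)` the `j`-th derivative of `T_n` grows at most like `n ^ j`. -/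
lemma isBigO_eval_iterate_derivative_T {c : ℝ} (hc : |c| < 1) (j : ℕ) :
    (fun n : ℕ => (derivative^[j] (Chebyshev.T ℝ (n + 1 : ℕ))).eval c)
      =O[atTop] fun n : ℕ => ((n : ℝ) + 1) ^ j := by
  have hpos : 0 < 1 - c ^ 2 := by nlinarith [abs_lt.1 hc, (abs_lt.1 hc).1, (abs_lt.1 hc).2]
  induction j using Nat.twoStepInduction with
  | zero =>
    refine IsBigO.of_bound 1 (Eventually.of_forall fun n => ?_)
    simpa using Chebyshev.abs_eval_T_real_le_one (n + 1 : ℕ) hc.le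
  | one =>
    refine IsBigO.of_bound (√(1 - c ^ 2))⁻¹ (Eventually.of_forall fun n => ?_)
    have h := abs_weightedU_le_one n (t := c) ⟨(abs_lt.1 hc).1.le, (abs_lt.1 hc).2.le⟩
    have hs := Real.sqrt_pos.2 hpos
    rw [weightedU, abs_mul, abs_of_pos hs] at h
    have hU : |(Chebyshev.U ℝ n).eval c| ≤ (√(1 - c ^ 2))⁻¹ := by
      rwa [← one_div, le_div_iff₀' hs]
    have hn : (0 : ℝ) ≤ (n : ℝ) + 1 := by positivity
    rw [Function.iterate_one, Chebyshev.T_derivative_eq_U]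
    have e : ((n + 1 : ℕ) : ℤ) - 1 = n := by push_cast; ring
    rw [e]
    simp only [eval_mul, eval_intCast, pow_one, Real.norm_eq_abs, abs_mul]
    push_cast
    rw [mul_comm]
    exact mul_le_mul_of_nonneg_right hU (abs_nonneg _)
  -- The Chebyshev equation differentiated `j` times: `(1 - x²) T^(j+2) = (2j+1) x T^(j+1) - (n² -
  -- j²) T^(j)`. Dividing by `1 - c²` needs `|c| < 1`.
  | more j ih0 ih1 =>
    have hdeg : (fun n : ℕ => ((n + 1 : ℕ) : ℝ) ^ 2 - (j : ℝ) ^ 2)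
        =O[atTop] fun n : ℕ => ((n : ℝ) + 1) ^ 2 := by
      refine IsBigO.sub ?_ ?_
      · simpa using isBigO_refl (fun n : ℕ => ((n : ℝ) + 1) ^ 2) atTop
      · refine IsBigO.of_bound ((j : ℝ) ^ 2) (Eventually.of_forall fun n => ?_)
        have : (1 : ℝ) ≤ ((n : ℝ) + 1) ^ 2 := one_le_pow₀ (by linarith [n.cast_nonneg (α := ℝ)])
        rw [Real.norm_of_nonneg (by positivity), Real.norm_of_nonneg (by positivity)]
        exact le_mul_of_one_le_right (by positivity) this
    have hle : (fun n : ℕ => ((n : ℝ) + 1) ^ (j + 1))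
        =O[atTop] fun n : ℕ => ((n : ℝ) + 1) ^ (j + 2) :=
      IsBigO.of_norm_le fun n => by
        rw [Real.norm_of_nonneg (by positivity)]
        exact pow_le_pow_right₀ (by linarith [n.cast_nonneg (α := ℝ)]) (by omega)
    have h2 := hdeg.mul ih0
    simp only [← pow_add, add_comm 2 j] at h2
    refine ((((ih1.trans hle).const_mul_left ((2 * j + 1) * c)).sub h2).const_mul_left
      (1 - c ^ 2)⁻¹).congr_left fun n => ?_
    have h := Chebyshev.one_sub_X_sq_mul_iterate_derivative_T_eval (n + 1 : ℕ) j c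
    rw [inv_mul_eq_div, div_eq_iff hpos.ne', mul_comm _ (1 - c ^ 2), h]
    push_cast
    ring

lemma isBigO_coeff_taylor_T {c : ℝ} (hc : |c| < 1) (j : ℕ) :
    (fun n : ℕ => (taylor c (Chebyshev.T ℝ (n + 1 : ℕ))).coeff j)
      =O[atTop] fun n : ℕ => ((n : ℝ) + 1) ^ j := by
  refine ((isBigO_eval_iterate_derivative_T hc j).const_mul_left ((j.factorial : ℝ)⁻¹)).congr_left
    fun n => ?_
  rw [taylor_coeff, ← factorial_smul_hasseDeriv, LinearMap.smul_apply, eval_smul, nsmul_eq_mul,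
    inv_mul_cancel_left₀ (by positivity)]

lemma aeval_algebraMap_add_of_pow_eq_zero {R S : Type*} [CommRing R] [Ring S] [Algebra R S]
    (p : R[X]) (c : R) {N : S} {k : ℕ} (hN : N ^ k = 0) :
    aeval (algebraMap R S c + N) p = ∑ j ∈ Finset.range k, (taylor c p).coeff j • N ^ j := by
  have h1 : aeval (algebraMap R S c + N) p = aeval N (taylor c p) := by
    rw [taylor_apply, aeval_comp, map_add, aeval_X, aeval_C, add_comm]
  rw [h1, aeval_eq_sum_range' (n := max ((taylor c p).natDegree + 1) k) (by omega)]
  refine (Finset.sum_subset (Finset.range_mono (le_max_right _ _)) fun j _ hj => ?_).symm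
  rw [pow_eq_zero_of_le (by simpa using hj) hN, smul_zero]

/-- The nilpotent part of a Jordan block. -/
lemma jordanBlock_eq (n : ℕ) (c : ℝ) :
    jordanBlock n c = algebraMap ℝ (Matrix (Fin n) (Fin n) ℝ) c + jordanBlock n 0 := by
  ext i j
  by_cases h : i = j <;> simp [jordanBlock, Matrix.algebraMap_matrix_apply, h]

lemma jordanBlock_zero_pow_apply (n j : ℕ) {a b : Fin n} (h : (b : ℕ) < a + j) :
    (jordanBlock n 0 ^ j) a b = 0 := by
  induction j generalizing b with
  | zero => exact Matrix.one_apply_ne (fun e => by simp [e] at h)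
  | succ j ih =>
    rw [pow_succ, Matrix.mul_apply]
    refine Finset.sum_eq_zero fun x _ => ?_
    by_cases hx : (x : ℕ) + 1 = b
    · rw [ih (by omega), zero_mul]
    · simp [jordanBlock, hx]

lemma jordanBlock_zero_pow_eq_zero (n : ℕ) : jordanBlock n 0 ^ n = 0 := by
  ext a b
  exact jordanBlock_zero_pow_apply n n (by omega)

/-- Only Taylor coefficients of order `j < n` enter. A block of size one sees only `j = 0`, so `|c|
= 1` is harmless there. -/
lemma isBigO_aeval_jordanBlock_T {n r : ℕ} {c : ℝ} (hn : n ≤ r + 1)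
    (hc : |c| < 1 ∨ |c| ≤ 1 ∧ n = 1) (a b : Fin n) :
    (fun d : ℕ => aeval (jordanBlock n c) (Chebyshev.T ℝ (d + 1 : ℕ)) a b)
      =O[atTop] fun d : ℕ => ((d : ℝ) + 1) ^ r := by
  have hmono : ∀ j ≤ r, (fun d : ℕ => ((d : ℝ) + 1) ^ j) =O[atTop]
      fun d : ℕ => ((d : ℝ) + 1) ^ r := fun j hj => IsBigO.of_norm_le fun d => by
    rw [Real.norm_of_nonneg (by positivity)]
    exact pow_le_pow_right₀ (by linarith [d.cast_nonneg (α := ℝ)]) hj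
  have hcoeff : ∀ j < n, (fun d : ℕ => (taylor c (Chebyshev.T ℝ (d + 1 : ℕ))).coeff j)
      =O[atTop] fun d : ℕ => ((d : ℝ) + 1) ^ r := by
    intro j hj
    refine IsBigO.trans ?_ (hmono j (by omega))
    rcases hc with hc | ⟨hc, rfl⟩
    · exact isBigO_coeff_taylor_T hc j
    · obtain rfl : j = 0 := by omega
      refine IsBigO.of_bound 1 (Eventually.of_forall fun d => ?_)
      simpa [taylor_coeff_zero] using Chebyshev.abs_eval_T_real_le_one (d + 1 : ℕ) hc
  simp only [jordanBlock_eq n c,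
    aeval_algebraMap_add_of_pow_eq_zero _ c (jordanBlock_zero_pow_eq_zero n), Matrix.sum_apply,
    Matrix.smul_apply, smul_eq_mul]
  refine IsBigO.fun_sum fun j hj => ?_
  simp only [mul_comm _ ((jordanBlock n 0 ^ j) a b)]
  exact (hcoeff j (Finset.mem_range.1 hj)).const_mul_left _

lemma aeval_units_conj {R S : Type*} [CommSemiring R] [Semiring S] [Algebra R S] (u : Sˣ) (x : S)
    (p : R[X]) : aeval (↑u⁻¹ * x * ↑u) p = ↑u⁻¹ * aeval x p * ↑u := by
  induction p using Polynomial.induction_on' with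
  | add p q hp hq => rw [map_add, map_add, hp, hq, mul_add, add_mul]
  | monomial n a =>
    rw [aeval_monomial, aeval_monomial, Units.conj_pow', ← Algebra.smul_def, ← Algebra.smul_def,
      mul_smul_comm, smul_mul_assoc]

lemma aeval_blockDiagonal' {o : Type*} [Fintype o] [DecidableEq o] {l : o → Type*}
    [∀ i, Fintype (l i)] [∀ i, DecidableEq (l i)] {R : Type*} [CommSemiring R]
    (M : ∀ i, Matrix (l i) (l i) R) (p : R[X]) :
    aeval (Matrix.blockDiagonal' M) p = Matrix.blockDiagonal' fun i => aeval (M i) p := by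
  induction p using Polynomial.induction_on' with
  | add p q hp hq =>
    simp only [map_add, hp, hq]
    exact (Matrix.blockDiagonal'_add _ _).symm
  | monomial n a =>
    simp only [aeval_monomial, ← Algebra.smul_def]
    exact ((Matrix.blockDiagonal'_smul a _).trans (congrArg _ (Matrix.blockDiagonal'_pow M n))).symm

lemma aeval_reindex {R m n : Type*} [CommSemiring R] [Fintype m] [DecidableEq m] [Fintype n]
    [DecidableEq n] (e : m ≃ n) (M : Matrix m m R) (p : R[X]) :
    aeval (Matrix.reindex e e M) p = Matrix.reindex e e (aeval M p) :=
  aeval_algHom_apply (Matrix.reindexAlgEquiv R R e) M p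

end Growth

/-! ### Jordan chains, semisimplicity and the growth of `T_n(A)`. -/

section Jordan

open Module

/-- The algebraic multiplicity is the dimension of the generalized eigenspace, which therefore
equals the eigenspace. Since `(A - c)²` kills `v`, already `A - c` does. -/
lemma mulVec_eq_smul_of_isSemisimpleEigenvalue {k : ℕ} {A : Matrix (Fin k) (Fin k) ℝ} {c : ℝ}
    (h : IsSemisimpleEigenvalue A c) {v w : Fin k → ℝ} (hv : A.mulVec v = c • v + w)
    (hw : A.mulVec w = c • w) : w = 0 := by
  have heq : End.eigenspace (Matrix.toLin' A) c = End.maxGenEigenspace (Matrix.toLin' A) c := by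
    refine Submodule.eq_of_le_of_finrank_eq (End.genEigenspace_le_maximal _ _ _) ?_
    rw [LinearMap.finrank_maxGenEigenspace_eq, Matrix.charpoly_toLin', h]
  have hmem : v ∈ End.maxGenEigenspace (Matrix.toLin' A) c := by
    rw [End.mem_maxGenEigenspace]
    refine ⟨2, ?_⟩
    simp [pow_two, hv, hw]
  rw [← heq, End.mem_eigenspace_iff, Matrix.toLin'_apply, hv] at hmem
  simpa using hmem

/-- The vectors of a Jordan chain. -/
lemma HasJordanForm.exists_chain {k : ℕ} {A : Matrix (Fin k) (Fin k) ℝ} {p : ℕ} {size : Fin p → ℕ}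
    {eig : Fin p → ℝ} (h : HasJordanForm A p size eig) (i : Fin p) :
    ∃ v : Fin (size i) → Fin k → ℝ, (∀ a, v a ≠ 0) ∧
      (∀ a : Fin (size i), (a : ℕ) = 0 → A.mulVec (v a) = eig i • v a) ∧
      ∀ a b : Fin (size i), (a : ℕ) + 1 = b → A.mulVec (v b) = eig i • v b + v a := by
  obtain ⟨-, e, Z, rfl⟩ := h
  set B := Matrix.blockDiagonal' fun i => jordanBlock (size i) (eig i)
  -- The change of basis intertwining `B` with `A`; the chain is the image of the standard basis
  -- vectors of block `i`.
  set t : (((i : Fin p) × Fin (size i)) → ℝ) → Fin k → ℝ :=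
    fun u => (↑Z⁻¹ : Matrix (Fin k) (Fin k) ℝ).mulVec (u ∘ e.symm)
  have hZ : (↑Z : Matrix (Fin k) (Fin k) ℝ) * (↑Z⁻¹ : Matrix (Fin k) (Fin k) ℝ) = 1 :=
    Units.mul_inv Z
  have ht : ∀ u, ((↑Z⁻¹ : Matrix (Fin k) (Fin k) ℝ) * Matrix.reindex e e B *
      (↑Z : Matrix (Fin k) (Fin k) ℝ)).mulVec (t u) = t (B.mulVec u) := by
    intro u
    simp only [t, Matrix.mulVec_mulVec, Matrix.mul_assoc, hZ, Matrix.mul_one]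
    rw [← Matrix.mulVec_mulVec, Matrix.reindex_apply, Matrix.submatrix_mulVec_equiv]
    simp [Function.comp_assoc]
  have ht0 : ∀ u, t u = 0 → u = 0 := by
    intro u hu
    have := congrArg (↑Z : Matrix (Fin k) (Fin k) ℝ).mulVec hu
    simp only [t, Matrix.mulVec_mulVec, hZ, Matrix.one_mulVec, Matrix.mulVec_zero] at this
    ext x
    simpa using congrFun this (e x)
  have hadd : ∀ u w, t (u + w) = t u + t w := fun u w => Matrix.mulVec_add _ _ _
  have hsmul : ∀ (c : ℝ) u, t (c • u) = c • t u := fun c u => Matrix.mulVec_smul _ _ _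
  refine ⟨fun a => t (Pi.single ⟨i, a⟩ 1), fun a ha => ?_, fun a ha => ?_, fun a b hab => ?_⟩
  · simpa using congrFun (ht0 _ ha) ⟨i, a⟩
  · rw [ht, ← hsmul, Matrix.mulVec_single_one]
    congr 1
    ext ⟨i', a'⟩
    by_cases hi : i' = i
    · subst hi
      by_cases haa : a' = a
      · simp [B, jordanBlock, Matrix.blockDiagonal'_apply, haa]
      · have : (a' : ℕ) + 1 ≠ a := by omega
        simp [B, jordanBlock, Matrix.blockDiagonal'_apply, haa, this]
    · simp [B, Matrix.blockDiagonal'_apply, hi]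
  · rw [ht, ← hsmul, ← hadd, Matrix.mulVec_single_one]
    congr 1
    ext ⟨i', a'⟩
    by_cases hi : i' = i
    · subst hi
      by_cases hb : a' = b
      · have : b ≠ a := fun e => by simp [e] at hab
        simp [B, jordanBlock, Matrix.blockDiagonal'_apply, hb, this]
      · by_cases haa : a' = a
        · simp [B, jordanBlock, Matrix.blockDiagonal'_apply, hab, haa, haa ▸ hb]
        · have : (a' : ℕ) + 1 ≠ b := fun e => haa (Fin.ext (by omega))
          simp [B, jordanBlock, Matrix.blockDiagonal'_apply, hb, haa, this]
    · simp [B, Matrix.blockDiagonal'_apply, hi]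

lemma HasJordanForm.hasEigenvalue {k : ℕ} {A : Matrix (Fin k) (Fin k) ℝ} {p : ℕ}
    {size : Fin p → ℕ} {eig : Fin p → ℝ} (h : HasJordanForm A p size eig) (i : Fin p) :
    End.HasEigenvalue (Matrix.toLin' A) (eig i) := by
  obtain ⟨v, hv0, hv, -⟩ := h.exists_chain i
  refine End.hasEigenvalue_of_hasEigenvector (x := v ⟨0, h.1 i⟩)
    (End.hasEigenvector_iff.2 ⟨End.mem_eigenspace_iff.2 ?_, hv0 _⟩)
  rw [Matrix.toLin'_apply, hv _ rfl]

/-- In a larger block, the second vector of the chain would force the first to vanish. -/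
lemma HasJordanForm.size_eq_one {k : ℕ} {A : Matrix (Fin k) (Fin k) ℝ} {p : ℕ}
    {size : Fin p → ℕ} {eig : Fin p → ℝ} (h : HasJordanForm A p size eig) {i : Fin p}
    (hi : IsSemisimpleEigenvalue A (eig i)) : size i = 1 := by
  obtain ⟨v, hv0, hv, hv'⟩ := h.exists_chain i
  by_contra hne
  have h1 : 1 < size i := lt_of_le_of_ne (h.1 i) (Ne.symm hne)
  exact hv0 ⟨0, h.1 i⟩ (mulVec_eq_smul_of_isSemisimpleEigenvalue hi
    (hv' ⟨0, h.1 i⟩ ⟨1, h1⟩ rfl) (hv _ rfl))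

open Asymptotics in
/-- The matrices `T_n(A)` grow at most like `n ^ (m - 1)`. -/
theorem IsCondense.isBigO_aeval_T {k : ℕ} {A : Matrix (Fin k) (Fin k) ℝ} {δ : ℝ} (hδ1 : δ < 1)
    (hA : IsCondense δ A) {m : ℕ} (hm : IsLargestJordanBlockSize A m) (a b : Fin k) :
    (fun n : ℕ => Polynomial.aeval A (Polynomial.Chebyshev.T ℝ (n + 1 : ℕ)) a b)
      =O[atTop] fun n : ℕ => ((n : ℝ) + 1) ^ (m - 1) := by
  obtain ⟨p, size, eig, hJ, -, hmax⟩ := hm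
  have hc : ∀ i, |eig i| < 1 ∨ |eig i| ≤ 1 ∧ size i = 1 := by
    intro i
    have hle := hA.abs_le_one _ (hJ.hasEigenvalue i)
    rcases lt_or_ge |eig i| δ with hlt | hge
    · exact Or.inl (hlt.trans hδ1)
    · refine Or.inr ⟨hle, hJ.size_eq_one (hA.semisimple _ ?_ (hJ.hasEigenvalue i))⟩
      obtain ⟨h1, h2⟩ := abs_le.1 hle
      rcases le_abs'.1 hge with h | h
      · exact Or.inl ⟨h1, h⟩
      · exact Or.inr ⟨h, h2⟩
  have hsize : ∀ i, size i ≤ m - 1 + 1 := fun i => by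
    have := hmax (mem_range_self i)
    omega
  obtain ⟨-, e, Z, rfl⟩ := hJ
  simp only [aeval_units_conj, aeval_reindex, aeval_blockDiagonal', Matrix.mul_apply]
  refine IsBigO.fun_sum fun y _ => ?_
  simp only [mul_comm _ ((↑Z : Matrix (Fin k) (Fin k) ℝ) y b)]
  refine (IsBigO.fun_sum fun x _ => IsBigO.const_mul_left ?_ _).const_mul_left _
  simp only [Matrix.reindex_apply, Matrix.submatrix_apply]
  generalize e.symm x = x'
  generalize e.symm y = y'
  obtain ⟨i, x'⟩ := x'
  obtain ⟨j, y'⟩ := y'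
  by_cases hij : i = j
  · subst hij
    simp only [Matrix.blockDiagonal'_apply_eq]
    exact isBigO_aeval_jordanBlock_T (hsize i) (hc i) x' y'
  · simp only [Matrix.blockDiagonal'_apply_ne _ _ _ hij]
    exact isBigO_zero _ _

/-- Reduces summability in an arbitrary norm to summability of each entry. -/
lemma _root_.AlgebraNorm.le_sum_abs_mul {n : Type*} [Fintype n] [DecidableEq n]
    (ν : AlgebraNorm ℝ (Matrix n n ℝ)) (M : Matrix n n ℝ) :
    ν M ≤ ∑ i, ∑ j, |M i j| * ν (Matrix.single i j 1) := by
  conv_lhs => rw [Matrix.matrix_eq_sum_single M]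
  refine (Finset.le_sum_of_subadditive ν (map_zero ν).le (map_add_le_add ν) _ _).trans
    (Finset.sum_le_sum fun i _ => ?_)
  refine (Finset.le_sum_of_subadditive ν (map_zero ν).le (map_add_le_add ν) _ _).trans_eq
    (Finset.sum_congr rfl fun j _ => ?_)
  rw [← Real.norm_eq_abs, ← map_smul_eq_mul, Matrix.smul_single, smul_eq_mul, mul_one]

end Jordan

end MatrixChebyshev

/-! ### Absolute convergence of the expansion. -/

open MatrixChebyshev Asymptotics

/-- The matrix Chebyshev expansion of `f` at a `δ`-condense matrix `A` converges absolutely in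
every sub-multiplicative matrix norm, and in particular it has a limit. -/
theorem mainTheorem3 {k : ℕ} (A : Matrix (Fin k) (Fin k) ℝ) (δ : ℝ) (hδ0 : 0 < δ) (hδ1 : δ < 1)
    (hA : MatrixChebyshev.IsCondense δ A)
    (m : ℕ) (hm : MatrixChebyshev.IsLargestJordanBlockSize A m)
    (f : ℝ → ℝ)
    (hf : ContDiffOn ℝ ((m - 1 : ℕ) : WithTop ℕ∞) f (Set.Icc (-1) 1))
    (hac : AbsolutelyContinuousOnInterval
      (iteratedDerivWithin (m - 1) f (Set.Icc (-1) 1)) (-1) 1)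
    (hbv : MatrixChebyshev.HasDerivOfBoundedVariation
      (iteratedDerivWithin (m - 1) f (Set.Icc (-1) 1))) :
    (∀ ν : AlgebraNorm ℝ (Matrix (Fin k) (Fin k) ℝ),
      Summable fun n : ℕ => ν (MatrixChebyshev.chebyshevTerm f A n)) ∧
    ∃ S : Matrix (Fin k) (Fin k) ℝ,
      Filter.Tendsto (MatrixChebyshev.chebyshevPartialSum f A) Filter.atTop (nhds S) := by
  obtain ⟨C, hC⟩ := exists_abs_chebyshevCoeff_mul_pow_le (m - 1) hf hac hbv
  have hcoeff : (fun n : ℕ => chebyshevCoeff f (n + 1))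
      =O[atTop] fun n : ℕ => (((n : ℝ) + 1) ^ (m - 1 + 2))⁻¹ := by
    refine IsBigO.of_bound C (Eventually.of_forall fun n => ?_)
    have hn : (0 : ℝ) < ((n : ℝ) + 1) ^ (m - 1 + 2) := by positivity
    rw [Real.norm_eq_abs, Real.norm_of_nonneg (inv_nonneg.2 hn.le), ← div_eq_mul_inv,
      le_div_iff₀ hn]
    exact hC n
  have hsq : Summable fun n : ℕ => (((n : ℝ) + 1) ^ 2)⁻¹ := by
    simpa using (summable_nat_add_iff 1).2 (Real.summable_nat_pow_inv.2 one_lt_two)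
  have hentry : ∀ a b, Summable fun n => |chebyshevTerm f A n a b| := by
    intro a b
    -- Dropping the term `n = 0` removes the factor `1 / 2`; the exponents `-(m - 1 + 2)` and `m -
    -- 1` then add up to `-2`.
    refine (summable_nat_add_iff 1).1 (summable_of_isBigO_nat hsq (IsBigO.abs_left ?_))
    refine (hcoeff.mul (hA.isBigO_aeval_T hδ1 hm a b)).congr (fun n => ?_) fun n => ?_
    · simp [chebyshevTerm]
    · rw [pow_add]
      field_simp
  refine ⟨fun ν => ?_, ?_⟩
  · refine Summable.of_nonneg_of_le (fun n => apply_nonneg ν _) (fun n => ν.le_sum_abs_mul _) ?_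
    exact summable_sum fun a _ => summable_sum fun b _ => (hentry a b).mul_right _
  · have hsum : Summable (chebyshevTerm f A) :=
      Pi.summable.2 fun a => Pi.summable.2 fun b => (hentry a b).of_abs
    exact ⟨_, hsum.hasSum.tendsto_sum_nat.comp (tendsto_add_atTop_nat 1)⟩
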